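/- Let $d\ge 2$ and let $X=\mathbb{T}^d=\mathbb{R}^d/\mathbb{Z}^d$ with normalized Lebesgue measure $dt$. For $A\in SL(d,\mathbb{Z})$ let $\tau_A$ be the automorphism $t\mapsto A^{t}t \bmod \mathbb{Z}^d$ of $X$ ($A^t$ being the transposed matrix). Let $\mathcal{A}\subset SL(d,\mathbb{Z})$ be a finite set satisfying the following uniform expansion condition, where $\|\cdot\|$ is the maximum norm: there are constants $C>0$, $\delta>0$, $\lambda>1$ such that $$\|A_1\cdots A_r\,p\|\ \ge\ C\,\|p\|^{-\delta}\lambda^r\qquad\text{for all } r\ge 1,\ A_1,\dots,A_r\in\mathcal{A},\ p\in\mathbb{Z}^d\setminus\{0\}.$$ Let $(\Omega,\mu)$ be a probability space, $\theta:\Omega\to\Omega$ an invertible (bimeasurable) ergodic $\mu$-preserving transformation, and $\omega\mapsto A(\omega)$ a measurable map from $\Omega$ to $\mathcal{A}$. Put $\tau(\omega)=\tau_{A(\omega)}$, $\theta_\tau(\omega,t)=(\theta\omega,\tau(\omega)t)$ on $\Omega\times X$, $\nu=\mu\otimes dt$, $\tau(k,\omega)=\tau(\theta^{k-1}\omega)\circ\cdots\circ\tau(\omega)$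 and, for $f:X\to\mathbb{R}$, $$S_n(\omega,f)(t)=\sum_{k=1}^n f(\tau(k,\omega)t).$$ Let $\alpha>0$ and let $f:\mathbb{T}^d\to\mathbb{R}$ be an $\alpha$-Hölder function with $\int f\,dt=0$. Then there is a real number $\sigma(f)$, not depending on $\omega$, such that for $\mu$-a.e. $\omega\in\Omega$ $$\lim_{n\to\infty} n^{-1/2}\,\|S_n(\omega,f)\|_{2}=\sigma(f),$$ where $\|\cdot\|_2$ is the $L^2(X,dt)$ norm with $\omega$ fixed. Moreover $\sigma(f)=0$ if and only if $f$ is a coboundary for $\theta_\tau$ with square integrable transfer function: there is $h\in L^2(\nu)$, real-valued, with $$f(t)=h(\theta\omega,\tau(\omega)t)-h(\omega,t)\qquad\text{for } \nu\text{-a.e. }(\omega,t).$$ -/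

import Mathlib

open MeasureTheory Filter Topology
open scoped NNReal ENNReal

noncomputable section

namespace ToralProducts

/-- `SL(d, ℤ)`. -/
abbrev SLZ (d : ℕ) : Type := Matrix.SpecialLinearGroup (Fin d) ℤ

/-- The torus `𝕋^d = ℝ^d / ℤ^d`. Its `volume` is the normalized Lebesgue measure and its distance is
`d(x, y) = inf_{n ∈ ℤ^d} ‖x - y - n‖` for the maximum norm. -/
abbrev Torus (d : ℕ) : Type := UnitAddTorus (Fin d)

/-- The endomorphism `x ↦ M x mod ℤ^d` of the torus given by an integer matrix `M`. -/
def toralMap {d : ℕ} (M : Matrix (Fin d) (Fin d) ℤ) (x : Torus d) : Torus d :=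
  fun i => ∑ j, M i j • x j

/-- The automorphism `τ_A` associated to `A ∈ SL(d, ℤ)`: `x ↦ Aᵗ x mod ℤ^d`. Thus composing the
character of frequency `p` with `τ_A` gives the character of frequency `A p`. -/
def tau {d : ℕ} (A : SLZ d) : Torus d → Torus d :=
  toralMap (A : Matrix (Fin d) (Fin d) ℤ).transpose

/-- Uniform expansion: there are `C > 0`, `δ > 0`, `lam > 1` such that
`‖A₁ ⋯ A_r p‖ ≥ C ‖p‖^(-δ) lam^r` for all `r ≥ 1`, `A₁, …, A_r ∈ 𝒜` and nonzero `p ∈ ℤ^d`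
(`‖·‖` is the maximum norm on `ℤ^d`). -/
def UniformExpansion {d : ℕ} (𝒜 : Finset (SLZ d)) : Prop :=
  ∃ C δ lam : ℝ, 0 < C ∧ 0 < δ ∧ 1 < lam ∧
    ∀ r : ℕ, 1 ≤ r → ∀ B : Fin r → SLZ d, (∀ i, B i ∈ 𝒜) →
      ∀ p : Fin d → ℤ, p ≠ 0 →
        C * ‖p‖ ^ (-δ) * lam ^ r ≤
          ‖((List.ofFn B).prod : Matrix (Fin d) (Fin d) ℤ).mulVec p‖

/-- The real `α`-Hölder functions on the torus with null integral. -/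
def holderCentered (d : ℕ) (α : ℝ≥0) : Set (Torus d → ℝ) :=
  {f | (∃ K : ℝ≥0, HolderWith K α f) ∧ ∫ t, f t = 0}

variable {Ω : Type*} {d : ℕ}

/-- The skew product `θ_τ (ω, t) = (θ ω, τ_{A(ω)} t)`. -/
def skewProduct (θ : Ω → Ω) (A : Ω → SLZ d) (z : Ω × Torus d) : Ω × Torus d :=
  (θ z.1, tau (A z.1) z.2)

/-- `τ(k, ω) = τ_{A(θ^{k-1} ω)} ∘ ⋯ ∘ τ_{A(ω)}`. -/
def tauProd (θ : Ω → Ω) (A : Ω → SLZ d) : ℕ → Ω → Torus d → Torus d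
  | 0, _, t => t
  | k + 1, ω, t => tau (A (θ^[k] ω)) (tauProd θ A k ω t)

/-- `S_n(ω, f)(t) = ∑_{k=1}^n f(τ(k, ω) t)`. -/
def birkhoffS (θ : Ω → Ω) (A : Ω → SLZ d) (n : ℕ) (ω : Ω) (f : Torus d → ℝ) (t : Torus d) : ℝ :=
  ∑ k ∈ Finset.Icc 1 n, f (tauProd θ A k ω t)

/-- `‖S_n(ω, f)‖₂`, the `L²` norm with respect to Lebesgue measure in `t`, with `ω` fixed. -/
def normS (θ : Ω → Ω) (A : Ω → SLZ d) (n : ℕ) (ω : Ω) (f : Torus d → ℝ) : ℝ :=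
  (eLpNorm (birkhoffS θ A n ω f) 2 volume).toReal

/-- `f` is an `L²(μ ⊗ Lebesgue)` coboundary for the skew product: there is a square integrable `h`
with `f(t) = h(θ ω, τ_{A(ω)} t) - h(ω, t)` almost everywhere. -/
def IsL2Coboundary [MeasurableSpace Ω] (μ : Measure Ω) (θ : Ω → Ω) (A : Ω → SLZ d)
    (f : Torus d → ℝ) : Prop :=
  ∃ h : Ω × Torus d → ℝ, MemLp h 2 (μ.prod volume) ∧
    ∀ᵐ z ∂(μ.prod volume), f z.2 = h (skewProduct θ A z) - h z

end ToralProducts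

end

/-! Up to an error bounded uniformly in n and ω, ‖S_n(ω, f)‖₂² is a Birkhoff sum over the base. A
Hölder function satisfies ∑ ‖p‖^α |c_p|² < ∞ (`summable_rpow_norm_mul_fcoeff_sq`). Composition with
τ_A moves frequency p to A p, so uniform expansion carries low frequencies to high ones, where f has
little mass. Correlations therefore decay exponentially, uniformly over products from 𝒜
(`exists_correlation_decay`).

The cross terms in the square of S_n are such correlations, and completing the truncated series
costs a bounded total error (`abs_sqS_sub_birkhoffSum_le`). So ‖S_n‖₂² = ∑_{k=1}^n ψ(θ^k ω) + O(1)
with ψ = `varDensity` bounded, and Birkhoff's theorem for θ gives σ² = ∫ ψ dμ.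

Integrated over ω, this says that the ergodic sums of f in L²(ν) have squared norm nσ² + O(1). Hence
σ = 0 exactly when they are bounded, which for an isometry of a Hilbert space characterizes
coboundaries (`bounded_ergodic_sums_iff`). -/

noncomputable section

namespace ToralProducts

/-! ### Birkhoff's theorem via the maximal inequality -/

section PointwiseErgodic

variable {X : Type*} {T : X → X} {g : X → ℝ}

/-- The maximal function `max_{0 ≤ k ≤ n} S_k g` of the Birkhoff sums, defined recursively. -/
def maximalSum (T : X → X) (g : X → ℝ) : ℕ → X → ℝ
  | 0, _ => 0
  | n + 1, x => max 0 (g x + maximalSum T g n (T x))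

lemma maximalSum_nonneg (n : ℕ) (x : X) : 0 ≤ maximalSum T g n x := by
  cases n with
  | zero => exact le_rfl
  | succ n => exact le_max_left _ _

lemma maximalSum_le_succ (n : ℕ) (x : X) : maximalSum T g n x ≤ maximalSum T g (n + 1) x := by
  induction n generalizing x with
  | zero => exact maximalSum_nonneg 1 x
  | succ n ih => exact max_le_max le_rfl (by gcongr; exact ih (T x))

lemma birkhoffSum_le_maximalSum (n : ℕ) (x : X) : birkhoffSum T g n x ≤ maximalSum T g n x := by
  induction n generalizing x with
  | zero => simp [maximalSum]
  | succ n ih =>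
    rw [birkhoffSum_succ']
    exact (add_le_add le_rfl (ih (T x))).trans (le_max_right _ _)

variable [MeasurableSpace X] {μ : Measure X}

lemma measurable_maximalSum (hT : Measurable T) (hg : Measurable g) (n : ℕ) :
    Measurable (maximalSum T g n) := by
  induction n with
  | zero => exact measurable_const
  | succ n ih => exact measurable_const.max (hg.add (ih.comp hT))

lemma integrable_maximalSum (hT : MeasurePreserving T μ μ) (hg : Integrable g μ) (n : ℕ) :
    Integrable (maximalSum T g n) μ := by
  induction n with
  | zero => exact integrable_zero _ _ _
  | succ n ih =>
    exact (integrable_zero X ℝ μ).sup (hg.add (hT.integrable_comp_of_integrable ih))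

/-- The maximal ergodic theorem. -/
lemma setIntegral_maximalSum_pos_nonneg (hT : MeasurePreserving T μ μ) (hgm : Measurable g)
    (hg : Integrable g μ) (n : ℕ) : 0 ≤ ∫ x in {x | 0 < maximalSum T g n x}, g x ∂μ := by
  have hM := integrable_maximalSum hT hg n
  have hmeas : MeasurableSet {x | 0 < maximalSum T g n x} :=
    measurableSet_lt measurable_const (measurable_maximalSum hT.measurable hgm n)
  have hMT : Integrable (fun x => maximalSum T g n (T x)) μ := hT.integrable_comp_of_integrable hM
  -- Garsia's argument: with M the maximal function, M ≤ 1_{M > 0} g + M ∘ T pointwise; after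
  -- integration the two integrals of M cancel by invariance.
  have hle : ∫ x, maximalSum T g n x ∂μ ≤
      ∫ x, ({x | 0 < maximalSum T g n x}.indicator g x + maximalSum T g n (T x)) ∂μ := by
    refine integral_mono hM ((hg.indicator hmeas).add hMT) fun x => ?_
    by_cases hx : 0 < maximalSum T g n x
    · rw [Set.indicator_of_mem (by exact hx)]
      cases n with
      | zero => exact absurd hx (lt_irrefl _)
      | succ n =>
        have h1 : maximalSum T g (n + 1) x = g x + maximalSum T g n (T x) := by
          rcases lt_max_iff.1 hx with h | h
          · exact absurd h (lt_irrefl _)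
          · exact max_eq_right h.le
        rw [h1]
        gcongr
        exact maximalSum_le_succ n (T x)
    · rw [Set.indicator_of_notMem (by exact hx), zero_add]
      exact (not_lt.1 hx).trans (maximalSum_nonneg n (T x))
  rw [integral_add (hg.indicator hmeas) hMT,
    integral_indicator hmeas] at hle
  have h2 : ∫ x, maximalSum T g n (T x) ∂μ = ∫ x, maximalSum T g n x ∂μ := by
    conv_rhs => rw [← hT.map_eq]
    refine (integral_map hT.measurable.aemeasurable ?_).symm
    exact (measurable_maximalSum hT.measurable hgm n).aestronglyMeasurable
  linarith

lemma measurable_birkhoffSum (hT : Measurable T) (hg : Measurable g) (n : ℕ) :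
    Measurable (birkhoffSum T g n) :=
  Finset.measurable_sum _ fun k _ => hg.comp (hT.iterate k)

/-- Birkhoff sums of a function with negative mean are almost surely bounded above. -/
lemma ae_birkhoffSum_bddAbove (hT : Ergodic T μ) (hgm : Measurable g)
    (hg : Integrable g μ) (hneg : ∫ x, g x ∂μ < 0) :
    ∀ᵐ x ∂μ, ∃ C : ℝ, ∀ n, birkhoffSum T g n x ≤ C := by
  set E : Set X := {x | ∀ m : ℕ, ∃ n, (m : ℝ) < birkhoffSum T g n x} with hE
  have hEmeas : MeasurableSet E := by
    have : E = ⋂ m : ℕ, ⋃ n, {x | (m : ℝ) < birkhoffSum T g n x} := by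
      ext x; simp [hE]
    rw [this]
    exact MeasurableSet.iInter fun m => MeasurableSet.iUnion fun n =>
      measurableSet_lt measurable_const (measurable_birkhoffSum hT.measurable hgm n)
  -- Passing from x to T x changes the sums only by g x and a shift of n, so unboundedness is
  -- invariant.
  have hEinv : T ⁻¹' E = E := by
    ext x
    constructor
    · intro hx m
      obtain ⟨k, hk⟩ := exists_nat_ge ((m : ℝ) - g x)
      obtain ⟨n, hn⟩ := hx k
      refine ⟨n + 1, ?_⟩
      rw [birkhoffSum_succ']
      linarith
    · intro hx m
      obtain ⟨k, hk⟩ := exists_nat_ge ((m : ℝ) + g x)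
      obtain ⟨n, hn⟩ := hx k
      cases n with
      | zero =>
        rw [birkhoffSum_zero] at hn
        exact absurd hn (not_lt.2 k.cast_nonneg)
      | succ n =>
        refine ⟨n, ?_⟩
        rw [birkhoffSum_succ'] at hn
        linarith
  rcases hT.toPreErgodic.ae_empty_or_univ hEmeas hEinv with h0 | h1
  · filter_upwards [ae_eq_empty.1 h0 |> measure_eq_zero_iff_ae_notMem.1] with x hx
    simp only [hE, Set.mem_ofPred_eq, not_forall, not_exists, not_lt] at hx
    obtain ⟨m, hm⟩ := hx
    exact ⟨m, hm⟩
  · exfalso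
    -- If E had full measure, the sets {M_n > 0} would increase to almost all of X, and the maximal
    -- inequality would force ∫ g ≥ 0.
    have hmono : Monotone fun n => {x | 0 < maximalSum T g n x} :=
      monotone_nat_of_le_succ fun n x hx => lt_of_lt_of_le hx (maximalSum_le_succ n x)
    have hlim := tendsto_setIntegral_of_monotone (μ := μ) (f := g)
      (fun n => measurableSet_lt measurable_const
        (measurable_maximalSum hT.measurable hgm n)) hmono hg.integrableOn
    have huniv : (⋃ n, {x | 0 < maximalSum T g n x}) =ᵐ[μ] Set.univ := by
      rw [eventuallyEq_univ]
      filter_upwards [eventuallyEq_univ.1 h1] with x hx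
      obtain ⟨n, hn⟩ := hx 0
      rw [Nat.cast_zero] at hn
      exact Set.mem_iUnion.2 ⟨n, hn.trans_le (birkhoffSum_le_maximalSum n x)⟩
    rw [setIntegral_congr_set huniv, setIntegral_univ] at hlim
    exact absurd (ge_of_tendsto' hlim
      fun n => setIntegral_maximalSum_pos_nonneg hT.toMeasurePreserving hgm hg n) (not_le.2 hneg)

/-- Subtracting the mean and a further 1/(m+1) makes the integral negative; countably many m give
one null set for all ε. -/
lemma ae_birkhoffSum_le [IsProbabilityMeasure μ] (hT : Ergodic T μ) (hgm : Measurable g)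
    (hg : Integrable g μ) :
    ∀ᵐ x ∂μ, ∀ ε : ℝ, 0 < ε → ∃ C : ℝ, ∀ n : ℕ,
      birkhoffSum T g n x ≤ n * (∫ y, g y ∂μ) + n * ε + C := by
  have key : ∀ m : ℕ, ∀ᵐ x ∂μ, ∃ C : ℝ, ∀ n : ℕ,
      birkhoffSum T g n x ≤ n * (∫ y, g y ∂μ) + n * (1 / ((m : ℝ) + 1)) + C := by
    intro m
    have hm : (0 : ℝ) < 1 / ((m : ℝ) + 1) := Nat.one_div_pos_of_nat
    have := ae_birkhoffSum_bddAbove hT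
      (g := fun x => g x - ((∫ y, g y ∂μ) + 1 / ((m : ℝ) + 1))) (hgm.sub_const _)
      (hg.sub (integrable_const _)) (by
        rw [integral_sub hg (integrable_const _)]
        simp only [integral_const, probReal_univ, one_smul]
        linarith)
    filter_upwards [this] with x hx
    obtain ⟨C, hC⟩ := hx
    refine ⟨C, fun n => ?_⟩
    have h := hC n
    simp only [birkhoffSum, Finset.sum_sub_distrib, Finset.sum_const, Finset.card_range,
      nsmul_eq_mul] at h ⊢
    linarith
  filter_upwards [ae_all_iff.2 key] with x hx ε hε
  obtain ⟨m, hm⟩ := exists_nat_one_div_lt hε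
  obtain ⟨C, hC⟩ := hx m
  refine ⟨C, fun n => (hC n).trans ?_⟩
  gcongr

/-- Birkhoff's pointwise ergodic theorem. -/
theorem ae_tendsto_birkhoffSum_div [IsProbabilityMeasure μ] (hT : Ergodic T μ)
    (hgm : Measurable g) (hg : Integrable g μ) :
    ∀ᵐ x ∂μ, Tendsto (fun n : ℕ => birkhoffSum T g n x / n) atTop (𝓝 (∫ y, g y ∂μ)) := by
  filter_upwards [ae_birkhoffSum_le hT hgm hg, ae_birkhoffSum_le hT hgm.neg hg.neg] with x h1 h2
  rw [Metric.tendsto_atTop]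
  intro ε hε
  obtain ⟨C, hC⟩ := h1 (ε / 2) (half_pos hε)
  obtain ⟨D, hD⟩ := h2 (ε / 2) (half_pos hε)
  -- Beyond N both additive constants are smaller than nε/2.
  obtain ⟨N, hN⟩ := exists_nat_gt (max (max C D / (ε / 2)) 0)
  refine ⟨N, fun n hn => ?_⟩
  have hNn : (N : ℝ) ≤ n := by exact_mod_cast hn
  have hn0 : (0 : ℝ) < n := (le_max_right _ _).trans_lt (hN.trans_le hNn)
  have hmax : max C D < n * (ε / 2) := by
    rw [← div_lt_iff₀ (half_pos hε)]
    exact (le_max_left _ _).trans_lt (hN.trans_le hNn)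
  have hC' := hC n
  have hD' := hD n
  have hneg : birkhoffSum T (-g) n x = -birkhoffSum T g n x := by
    simp [birkhoffSum]
  simp only [Pi.neg_apply, integral_neg] at hD'
  rw [hneg] at hD'
  have hCm := le_max_left C D
  have hDm := le_max_right C D
  rw [Real.dist_eq, div_sub' hn0.ne', abs_div, abs_of_pos hn0, div_lt_iff₀ hn0, abs_lt]
  constructor <;> linarith

end PointwiseErgodic

/-! ### Coboundaries of isometries of a Hilbert space -/

section HilbertCoboundary

variable {H : Type*} [NormedAddCommGroup H] [InnerProductSpace ℝ H]

lemma map_birkhoffSum_id (U : H →ₗᵢ[ℝ] H) (F : H) (n : ℕ) :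
    U (birkhoffSum U id n F) = birkhoffSum U id (n + 1) F - F := by
  rw [birkhoffSum_succ', birkhoffSum, birkhoffSum, map_sum]
  simp only [id, add_sub_cancel_left]
  exact Finset.sum_congr rfl fun k _ => (Function.iterate_succ_apply' U k F).symm.trans
    (Function.iterate_succ_apply U k F)

/-- An element of a Hilbert space is a coboundary of a linear isometry if and only if its ergodic
sums are bounded. -/
theorem bounded_ergodic_sums_iff [CompleteSpace H] (U : H →ₗᵢ[ℝ] H) (F : H) :
    (∃ M : ℝ, ∀ n : ℕ, ‖birkhoffSum U id n F‖ ≤ M) ↔ ∃ h : H, U h - h = F := by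
  constructor
  · rintro ⟨M, hM⟩
    -- Minus the Cesàro means of the ergodic sums: bounded by M, and approximate solutions, since
    -- telescoping gives U W_N - W_N = F - S_N F / N.
    set W : ℕ → H := fun N => -((N : ℝ)⁻¹ • ∑ n ∈ Finset.range N, birkhoffSum U id n F) with hW
    have hWbound : ∀ N, ‖W N‖ ≤ M := by
      intro N
      have hM0 : 0 ≤ M := (norm_nonneg _).trans (hM 0)
      rw [hW, norm_neg, norm_smul, norm_inv, Real.norm_natCast]
      rcases Nat.eq_zero_or_pos N with rfl | hN
      · simpa using hM0
      · have hN' : (0 : ℝ) < N := by exact_mod_cast hN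
        rw [inv_mul_le_iff₀ hN']
        refine (norm_sum_le_of_le _ fun n _ => hM n).trans ?_
        simp
    have hWeq : ∀ N : ℕ, 0 < N → U (W N) - W N = F - (N : ℝ)⁻¹ • birkhoffSum U id N F := by
      intro N hN
      have hN' : (N : ℝ) ≠ 0 := by exact_mod_cast hN.ne'
      have h1 : ∑ n ∈ Finset.range N, birkhoffSum U id n F -
          ∑ n ∈ Finset.range N, birkhoffSum U id (n + 1) F = - birkhoffSum U id N F := by
        rw [← Finset.sum_sub_distrib, Finset.sum_range_sub', birkhoffSum_zero, zero_sub]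
      simp only [hW, map_neg, map_smul, map_sum, map_birkhoffSum_id,
        Finset.sum_sub_distrib, Finset.sum_const, Finset.card_range]
      rw [← Nat.cast_smul_eq_nsmul ℝ, smul_sub, smul_smul, inv_mul_cancel₀ hN', one_smul,
        eq_sub_iff_add_eq]
      have h2 := congrArg (fun v => (N : ℝ)⁻¹ • v) h1
      simp only [smul_sub, smul_neg] at h2
      rw [← sub_eq_zero] at h2 ⊢
      rw [← h2]
      abel
    have hlim0 : Tendsto (fun N : ℕ => (N : ℝ)⁻¹ • birkhoffSum U id N F) atTop (𝓝 0) := by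
      refine squeeze_zero_norm (a := fun N : ℕ => (N : ℝ)⁻¹ * M) (fun N => ?_) ?_
      · rw [norm_smul, norm_inv, Real.norm_natCast]
        gcongr
        exact hM N
      · simpa using (tendsto_inv_atTop_nhds_zero_nat (𝕜 := ℝ)).mul_const M
    -- A weak limit of W_N exists by Banach–Alaoglu; an ultrafilter replaces a subsequence, as H
    -- need not be separable.
    set 𝒰 : Ultrafilter ℕ := hyperfilter ℕ
    have h𝒰 : (𝒰 : Filter ℕ) ≤ atTop := Nat.hyperfilter_le_atTop
    set Λ : ℕ → WeakDual ℝ H := fun N => StrongDual.toWeakDual (InnerProductSpace.toDual ℝ H (W N))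
    have hΛ : ∀ N, Λ N ∈ WeakDual.toStrongDual ⁻¹' Metric.closedBall (0 : StrongDual ℝ H) M := by
      intro N
      simp only [Set.mem_preimage, mem_closedBall_zero_iff]
      exact ((InnerProductSpace.toDual ℝ H).norm_map (W N)).le.trans (hWbound N)
    obtain ⟨ℓ, -, hℓ⟩ := (WeakDual.isCompact_closedBall (0 : StrongDual ℝ H) M).ultrafilter_le_nhds'
      (𝒰.map Λ) (Ultrafilter.mem_map.2 (Filter.Eventually.of_forall hΛ))
    set h : H := (InnerProductSpace.toDual ℝ H).symm (WeakDual.toStrongDual ℓ) with hh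
    have hinner : ∀ v, Tendsto (fun N => inner ℝ (W N) v) (𝒰 : Filter ℕ) (𝓝 (inner ℝ h v)) := by
      intro v
      have h1 : inner ℝ h v = ℓ v := by
        rw [hh, InnerProductSpace.toDual_symm_apply]
        rfl
      rw [h1]
      exact ((WeakDual.eval_continuous v).tendsto ℓ).comp hℓ
    refine ⟨h, ext_inner_right ℝ fun v => ?_⟩
    have hA : Tendsto (fun N => inner ℝ (U (W N) - W N) v) (𝒰 : Filter ℕ)
        (𝓝 (inner ℝ (U h - h) v)) := by
      simp only [inner_sub_left]
      refine Tendsto.sub ?_ (hinner v)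
      -- Moving U onto v through the adjoint lets the weak limit pass through U.
      have hadj : ∀ w, inner ℝ (U w) v =
          inner ℝ w (ContinuousLinearMap.adjoint U.toContinuousLinearMap v) := fun w =>
        (ContinuousLinearMap.adjoint_inner_right U.toContinuousLinearMap w v).symm
      simp only [hadj]
      exact hinner _
    have hB : Tendsto (fun N => inner ℝ (U (W N) - W N) v) (𝒰 : Filter ℕ) (𝓝 (inner ℝ F v)) := by
      have h1 : Tendsto (fun N : ℕ => inner ℝ (F - (N : ℝ)⁻¹ • birkhoffSum U id N F) v)
          atTop (𝓝 (inner ℝ F v)) := by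
        have := (tendsto_const_nhds (x := F)).sub hlim0
        rw [sub_zero] at this
        exact this.inner tendsto_const_nhds
      refine (h1.mono_left h𝒰).congr' ?_
      filter_upwards [h𝒰 (eventually_gt_atTop 0)] with N hN
      rw [hWeq N hN]
    exact tendsto_nhds_unique hA hB
  · rintro ⟨h, rfl⟩
    have htel : ∀ n, birkhoffSum U id n (U h - h) = U^[n] h - h := by
      intro n
      induction n with
      | zero => simp
      | succ n ih =>
        have hit : U^[n] (U h - h) = U^[n] (U h) - U^[n] h := iterate_map_sub U n (U h) h
        rw [birkhoffSum_succ, ih, id, hit, Function.iterate_succ_apply]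
        abel
    have hnorm : ∀ n, ‖U^[n] h‖ = ‖h‖ := by
      intro n
      induction n with
      | zero => rfl
      | succ n ih => rw [Function.iterate_succ_apply', U.norm_map, ih]
    refine ⟨‖h‖ + ‖h‖, fun n => ?_⟩
    rw [htel]
    exact (norm_sub_le _ _).trans (by rw [hnorm])

end HilbertCoboundary

/-! ### Toral automorphisms and characters -/

section TorusMaps

variable {d : ℕ}

lemma volume_torus :
    (volume : Measure (Torus d)) = Measure.pi fun _ => AddCircle.haarAddCircle := by
  rw [volume_pi]
  congr
  funext i
  simp [AddCircle.volume_eq_smul_haarAddCircle]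

instance isProbabilityMeasure_volume_torus : IsProbabilityMeasure (volume : Measure (Torus d)) := by
  rw [volume_torus]
  infer_instance

lemma toralMap_mul (M N : Matrix (Fin d) (Fin d) ℤ) (x : Torus d) :
    toralMap (M * N) x = toralMap M (toralMap N x) := by
  funext i
  simp only [toralMap, Matrix.mul_apply, Finset.sum_smul, Finset.smul_sum, mul_smul]
  exact Finset.sum_comm

lemma toralMap_one (x : Torus d) : toralMap 1 x = x := by
  funext i
  simp [toralMap, Matrix.one_apply, ite_smul]

/-- Transposition reverses products, so composing maps on the left multiplies matrices on the right,
as in the expansion condition. -/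
lemma tau_mul (A B : SLZ d) (x : Torus d) : tau (A * B) x = tau B (tau A x) := by
  simp only [tau, Matrix.SpecialLinearGroup.coe_mul, Matrix.transpose_mul, toralMap_mul]

lemma tau_one (x : Torus d) : tau (1 : SLZ d) x = x := by
  simp only [tau, Matrix.SpecialLinearGroup.coe_one, Matrix.transpose_one, toralMap_one]

lemma continuous_tau (A : SLZ d) : Continuous (tau A) := by
  unfold tau toralMap
  fun_prop

/-- A continuous surjective endomorphism of a compact group preserves normalized Haar measure;
surjectivity comes from A⁻¹. -/
lemma measurePreserving_tau (A : SLZ d) : MeasurePreserving (tau A) volume volume := by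
  let φ : Torus d →+ Torus d :=
    { toFun := tau A
      map_zero' := by funext i; simp [tau, toralMap]
      map_add' := fun x y => by
        funext i; simp [tau, toralMap, smul_add, Finset.sum_add_distrib] }
  refine AddMonoidHom.measurePreserving (f := φ) (continuous_tau A) (fun x => ?_) rfl
  refine ⟨tau A⁻¹ x, ?_⟩
  change tau A (tau A⁻¹ x) = x
  rw [← tau_mul, inv_mul_cancel, tau_one]

lemma mFourier_eq_toCircle (p : Fin d → ℤ) (x : Torus d) :
    UnitAddTorus.mFourier p x = (AddCircle.toCircle (∑ i, p i • x i) : ℂ) := by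
  simp only [UnitAddTorus.mFourier, ContinuousMap.coe_mk, fourier_apply]
  induction (Finset.univ : Finset (Fin d)) using Finset.cons_induction with
  | empty => simp
  | cons i s hi ih =>
    rw [Finset.prod_cons, Finset.sum_cons, AddCircle.toCircle_add, ih, Circle.coe_mul]

/-- Composing the character of frequency `p` with `τ_A` gives the character of frequency `A p`. -/
lemma mFourier_tau (A : SLZ d) (p : Fin d → ℤ) (x : Torus d) :
    UnitAddTorus.mFourier p (tau A x) =
      UnitAddTorus.mFourier ((A : Matrix (Fin d) (Fin d) ℤ).mulVec p) x := by
  rw [mFourier_eq_toCircle, mFourier_eq_toCircle]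
  congr 2
  simp only [tau, toralMap, Matrix.transpose_apply, Finset.smul_sum, Matrix.mulVec, dotProduct,
    Finset.sum_smul, mul_smul]
  rw [Finset.sum_comm]
  exact Finset.sum_congr rfl fun i _ => Finset.sum_congr rfl fun j _ => smul_comm _ _ _

end TorusMaps

/-! ### Parseval, translations and dyadic shifts -/

section Fourier

variable {d : ℕ}

/-- The Fourier coefficients of a function on the torus. -/
def fcoeff (f : Torus d → ℂ) (p : Fin d → ℤ) : ℂ := ∫ t, UnitAddTorus.mFourier (-p) t * f t

lemma hasSum_fcoeff (f g : C(Torus d, ℂ)) :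
    HasSum (fun p => starRingEnd ℂ (fcoeff f p) * fcoeff g p)
      (∫ t, starRingEnd ℂ (f t) * g t) := by
  simp only [fcoeff]
  rw [volume_torus]
  have h := UnitAddTorus.hasSum_prod_mFourierCoeff 
    (f.toLp 2 (Measure.pi fun _ => AddCircle.haarAddCircle) ℂ)
    (g.toLp 2 (Measure.pi fun _ => AddCircle.haarAddCircle) ℂ)
  have hc : ∀ (f : C(Torus d, ℂ)) (p : Fin d → ℤ),
      ∫ t, UnitAddTorus.mFourier (-p) t * f t ∂(Measure.pi fun _ => AddCircle.haarAddCircle) =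
        UnitAddTorus.mFourierCoeff
          (f.toLp 2 (Measure.pi fun _ => AddCircle.haarAddCircle) ℂ) p :=
    fun f p => (UnitAddTorus.mFourierCoeff_toLp f p).symm
  have hi : ∫ t, starRingEnd ℂ (f t) * g t ∂(Measure.pi fun _ => AddCircle.haarAddCircle) =
      ∫ t, starRingEnd ℂ (f.toLp 2 (Measure.pi fun _ => AddCircle.haarAddCircle) ℂ t) *
        g.toLp 2 (Measure.pi fun _ => AddCircle.haarAddCircle) ℂ t
          ∂(Measure.pi fun _ => AddCircle.haarAddCircle) := by
    refine integral_congr_ae ?_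
    filter_upwards [ContinuousMap.coeFn_toLp (p := 2) (𝕜 := ℂ)
        (Measure.pi fun _ => AddCircle.haarAddCircle) f,
      ContinuousMap.coeFn_toLp (p := 2) (𝕜 := ℂ)
        (Measure.pi fun _ => AddCircle.haarAddCircle) g] with t h1 h2
    rw [h1, h2]
  simp only [hc, hi]
  exact h

lemma hasSum_norm_fcoeff_sq (f : C(Torus d, ℂ)) :
    HasSum (fun p => ‖fcoeff f p‖ ^ 2) (∫ t, ‖f t‖ ^ 2) := by
  have h := hasSum_fcoeff f f
  simp only [← Complex.normSq_eq_conj_mul_self, Complex.normSq_eq_norm_sq] at h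
  rw [integral_complex_ofReal] at h
  exact_mod_cast h

lemma integrable_torus {E : Type*} [NormedAddCommGroup E] {f : Torus d → E} (hf : Continuous f) :
    Integrable f volume :=
  hf.integrable_of_hasCompactSupport (HasCompactSupport.of_compactSpace f)

lemma fcoeff_comp_add (f : Torus d → ℂ) (h : Torus d) (p : Fin d → ℤ) :
    fcoeff (fun t => f (t + h)) p = UnitAddTorus.mFourier p h * fcoeff f p := by
  have hchar : ∀ t, UnitAddTorus.mFourier (-p) t =
      UnitAddTorus.mFourier p h * UnitAddTorus.mFourier (-p) (t + h) := by
    intro t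
    simp only [mFourier_eq_toCircle, ← Circle.coe_mul, ← AddCircle.toCircle_add, Pi.neg_apply,
      Pi.add_apply, neg_smul, smul_add, Finset.sum_neg_distrib, Finset.sum_add_distrib]
    congr 2
    abel
  simp only [fcoeff]
  rw [← integral_const_mul,
    ← integral_add_right_eq_self (fun t => UnitAddTorus.mFourier p h * _) h]
  refine integral_congr_ae (Eventually.of_forall fun t => ?_)
  simp only
  rw [hchar t, mul_assoc]

lemma fcoeff_sub {f g : Torus d → ℂ} (hf : Continuous f) (hg : Continuous g) (p : Fin d → ℤ) :
    fcoeff (fun t => f t - g t) p = fcoeff f p - fcoeff g p := by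
  simp only [fcoeff, mul_sub]
  exact integral_sub (integrable_torus (by fun_prop)) (integrable_torus (by fun_prop))

lemma fcoeff_comp_tau {f : Torus d → ℂ} (hf : Continuous f) (A : SLZ d) (p : Fin d → ℤ) :
    fcoeff (fun t => f (tau A t)) ((A : Matrix (Fin d) (Fin d) ℤ).mulVec p) = fcoeff f p := by
  have hc : Continuous fun t => UnitAddTorus.mFourier (-p) t * f t := by fun_prop
  have h : ∫ t, UnitAddTorus.mFourier (-p) (tau A t) * f (tau A t) = fcoeff f p := by
    unfold fcoeff
    conv_rhs => rw [← (measurePreserving_tau A).map_eq]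
    exact (integral_map (measurePreserving_tau A).measurable.aemeasurable
      hc.aestronglyMeasurable).symm
  rw [← h]
  simp only [fcoeff, mFourier_tau, Matrix.mulVec_neg]

/-- The dyadic translate `2^{-k-2} e_i` on the torus. -/
def dyadicShift (i : Fin d) (k : ℕ) : Torus d :=
  Pi.single i (((1 / 2 : ℝ) ^ (k + 2) : ℝ) : UnitAddCircle)

lemma norm_dyadicShift_le (i : Fin d) (k : ℕ) : ‖dyadicShift i k‖ ≤ (1 / 2 : ℝ) ^ (k + 2) := by
  refine (pi_norm_le_iff_of_nonneg (by positivity)).2 fun j => ?_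
  by_cases hj : j = i
  · subst hj
    rw [dyadicShift, Pi.single_eq_same]
    refine (QuotientAddGroup.norm_mk_le_norm).trans ?_
    rw [Real.norm_of_nonneg (by positivity)]
  · rw [dyadicShift, Pi.single_eq_of_ne hj, norm_zero]
    positivity

/-- With 2^k ≤ |p_i| ≤ 2^(k+1), the phase x = p_i 2^(-k-2) satisfies 1/4 ≤ |x| ≤ 1/2, and Jordan's
inequality gives 2 sin(π|x|) ≥ 4|x| ≥ 1. -/
lemma one_le_norm_mFourier_dyadicShift_sub_one (p : Fin d → ℤ) (i : Fin d) (hp : p i ≠ 0) :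
    1 ≤ ‖UnitAddTorus.mFourier p (dyadicShift i (Nat.log 2 (p i).natAbs)) - 1‖ := by
  set k := Nat.log 2 (p i).natAbs with hk
  have hlow : (2 : ℝ) ^ k ≤ |(p i : ℝ)| := by
    have := Nat.pow_log_le_self 2 (Int.natAbs_ne_zero.2 hp)
    have h2 : ((p i).natAbs : ℝ) = |(p i : ℝ)| := by simp [Nat.cast_natAbs]
    rw [← h2]
    exact_mod_cast this
  have hupp : |(p i : ℝ)| ≤ 2 ^ (k + 1) := by
    have := (Nat.lt_pow_succ_log_self one_lt_two (p i).natAbs).le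
    have h2 : ((p i).natAbs : ℝ) = |(p i : ℝ)| := by simp [Nat.cast_natAbs]
    rw [← h2]
    exact_mod_cast this
  set x : ℝ := (p i : ℝ) * (1 / 2) ^ (k + 2) with hx
  have hpow : (2 : ℝ) ^ k * (1 / 2) ^ k = 1 := by rw [← mul_pow]; norm_num
  have hxabs : |x| = |(p i : ℝ)| * (1 / 2) ^ (k + 2) := by
    rw [hx, abs_mul, abs_of_pos (a := (1 / 2 : ℝ) ^ (k + 2)) (by positivity)]
  have h1 : 1 / 4 ≤ |x| := by
    rw [hxabs]
    calc (1 / 4 : ℝ) = 2 ^ k * (1 / 2) ^ (k + 2) := by rw [pow_add, ← mul_assoc, hpow]; norm_num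
      _ ≤ _ := by gcongr
  have h2 : |x| ≤ 1 / 2 := by
    rw [hxabs]
    calc _ ≤ (2 : ℝ) ^ (k + 1) * (1 / 2) ^ (k + 2) := by gcongr
      _ = 1 / 2 := by rw [pow_add, pow_add, mul_mul_mul_comm, hpow]; norm_num
  have hval : UnitAddTorus.mFourier p (dyadicShift i k) =
      Complex.exp (Complex.I * ((2 * Real.pi * x : ℝ) : ℂ)) := by
    rw [mFourier_eq_toCircle, Finset.sum_eq_single i]
    · rw [dyadicShift, Pi.single_eq_same, ← fourier_apply, fourier_coe_apply, hx]
      congr 1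
      push_cast
      ring
    · intro j _ hj
      rw [dyadicShift, Pi.single_eq_of_ne hj, smul_zero]
    · simp
  rw [hval, Complex.norm_exp_I_mul_ofReal_sub_one]
  have hsin : |Real.sin (2 * Real.pi * x / 2)| = Real.sin (Real.pi * |x|) := by
    rw [show 2 * Real.pi * x / 2 = Real.pi * x by ring]
    have hnn : 0 ≤ Real.sin (Real.pi * |x|) :=
      Real.sin_nonneg_of_nonneg_of_le_pi (by positivity) (by nlinarith [Real.pi_pos])
    rcases abs_choice x with h | h
    · rw [h] at hnn ⊢
      exact abs_of_nonneg hnn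
    · rw [h] at hnn ⊢
      rw [mul_neg, Real.sin_neg] at hnn ⊢
      rw [abs_of_nonpos (by linarith)]
  rw [norm_mul, Real.norm_eq_abs, Real.norm_eq_abs, hsin, abs_of_pos (two_pos : (0:ℝ) < 2)]
  have hmul := Real.mul_le_sin (x := Real.pi * |x|) (by positivity) (by nlinarith [Real.pi_pos])
  have : 2 / Real.pi * (Real.pi * |x|) = 2 * |x| := by
    field_simp
  linarith

end Fourier

/-! ### Fractional Sobolev regularity of Hölder functions -/

section Sobolev

variable {d : ℕ}

/-- Parseval for t ↦ f(t + h) - f(t), whose sup norm the Hölder condition controls. -/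
lemma tsum_shift_fcoeff_le {α K η : ℝ} (hα : 0 ≤ α) (hK : 0 ≤ K) (f : C(Torus d, ℂ))
    (hf : ∀ x y, ‖f x - f y‖ ≤ K * dist x y ^ α) (h : Torus d) (hh : ‖h‖ ≤ η) :
    ∑' p, ENNReal.ofReal (‖UnitAddTorus.mFourier p h - 1‖ ^ 2 * ‖fcoeff f p‖ ^ 2) ≤
      ENNReal.ofReal ((K * η ^ α) ^ 2) := by
  have hη : 0 ≤ η := (norm_nonneg h).trans hh
  have hg := hasSum_norm_fcoeff_sq (⟨fun t => f (t + h) - f t, by fun_prop⟩ : C(Torus d, ℂ))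
  have hco : ∀ p, fcoeff (⟨fun t => f (t + h) - f t, by fun_prop⟩ : C(Torus d, ℂ)) p =
      (UnitAddTorus.mFourier p h - 1) * fcoeff f p := by
    intro p
    rw [ContinuousMap.coe_mk, fcoeff_sub (by fun_prop) (by fun_prop), fcoeff_comp_add, sub_mul,
      one_mul]
  simp only [hco, norm_mul, mul_pow] at hg
  rw [← ENNReal.ofReal_tsum_of_nonneg (fun p => by positivity) hg.summable, hg.tsum_eq]
  refine ENNReal.ofReal_le_ofReal ?_
  have hle : ∀ t, ‖f (t + h) - f t‖ ^ 2 ≤ (K * η ^ α) ^ 2 := by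
    intro t
    have := hf (t + h) t
    rw [dist_self_add_left] at this
    gcongr
    exact this.trans (by gcongr)
  refine (integral_mono (integrable_torus (by fun_prop)) (integrable_const _) hle).trans ?_
  simp

/-- One term suffices: i a coordinate of maximal size and k its dyadic scale. -/
lemma rpow_norm_le_tsum {α : ℝ} (hα : 0 < α) (p : Fin d → ℤ) :
    ENNReal.ofReal (‖p‖ ^ α) ≤ ∑' ik : Fin d × ℕ, ENNReal.ofReal (2 ^ (α * (ik.2 + 1))) *
      ENNReal.ofReal (‖UnitAddTorus.mFourier p (dyadicShift ik.1 ik.2) - 1‖ ^ 2) := by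
  rcases eq_or_ne p 0 with rfl | hp
  · simp [Real.zero_rpow hα.ne']
  obtain ⟨j, hj⟩ := Function.ne_iff.1 hp
  have : Nonempty (Fin d) := ⟨j⟩
  obtain ⟨i, hi⟩ := Finite.exists_max fun i => ‖p i‖
  have hpi : p i ≠ 0 := by
    intro h0
    have := hi j
    rw [h0, norm_zero] at this
    exact hj (norm_le_zero_iff.1 this)
  have hnorm : ‖p‖ ≤ ‖p i‖ := (pi_norm_le_iff_of_nonneg (norm_nonneg _)).2 hi
  refine le_trans ?_ (ENNReal.le_tsum (i, Nat.log 2 (p i).natAbs))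
  rw [← ENNReal.ofReal_mul (by positivity)]
  refine ENNReal.ofReal_le_ofReal ?_
  have h1 := one_le_norm_mFourier_dyadicShift_sub_one p i hpi
  have h2 : ‖p i‖ ≤ 2 ^ ((Nat.log 2 (p i).natAbs : ℝ) + 1) := by
    have := (Nat.lt_pow_succ_log_self one_lt_two (p i).natAbs).le
    have h2 : ((p i).natAbs : ℝ) = ‖p i‖ := by simp [Nat.cast_natAbs, Int.norm_eq_abs]
    rw [← h2, ← Nat.cast_succ, Real.rpow_natCast]
    exact_mod_cast this
  calc ‖p‖ ^ α ≤ (2 ^ ((Nat.log 2 (p i).natAbs : ℝ) + 1)) ^ α := by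
        gcongr
        exact hnorm.trans h2
    _ = 2 ^ (α * ((Nat.log 2 (p i).natAbs : ℝ) + 1)) * 1 := by
        rw [← Real.rpow_mul zero_le_two, mul_comm, mul_one]
    _ ≤ _ := by
        gcongr
        exact one_le_pow₀ h1

/-- Hölder functions of exponent `α` have `α / 2` derivatives in `L²`. -/
lemma summable_rpow_norm_mul_fcoeff_sq {α K : ℝ} (hα : 0 < α) (hK : 0 ≤ K) (f : C(Torus d, ℂ))
    (hf : ∀ x y, ‖f x - f y‖ ≤ K * dist x y ^ α) :
    Summable fun p => ‖p‖ ^ α * ‖fcoeff f p‖ ^ 2 := by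
  have hq1 : (2 : ℝ) ^ (-α) < 1 := Real.rpow_lt_one_of_one_lt_of_neg one_lt_two (by linarith)
  have hfin : ∑' p, ENNReal.ofReal (‖p‖ ^ α * ‖fcoeff f p‖ ^ 2) ≠ ∞ := by
    -- At scale k the weight 2^(α(k+1)) meets the squared Hölder bound K² 2^(-2α(k+2)); the product
    -- is at most K² 2^(-αk). Weight exponent 2α would leave no decay.
    refine ne_top_of_le_ne_top (b := ∑' ik : Fin d × ℕ,
      ENNReal.ofReal (K ^ 2 * (2 ^ (-α)) ^ ik.2)) ?_ ?_
    · rw [ENNReal.tsum_prod (f := fun (_ : Fin d) k => ENNReal.ofReal (K ^ 2 * (2 ^ (-α)) ^ k)),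
        tsum_fintype]
      refine ENNReal.sum_ne_top.2 fun i _ => ?_
      exact ((summable_geometric_of_lt_one (by positivity) hq1).mul_left _).tsum_ofReal_ne_top
    · calc ∑' p, ENNReal.ofReal (‖p‖ ^ α * ‖fcoeff f p‖ ^ 2)
          ≤ ∑' p, ∑' ik : Fin d × ℕ, ENNReal.ofReal (2 ^ (α * (ik.2 + 1))) *
            ENNReal.ofReal (‖UnitAddTorus.mFourier p (dyadicShift ik.1 ik.2) - 1‖ ^ 2 *
              ‖fcoeff f p‖ ^ 2) := by
            refine ENNReal.tsum_le_tsum fun p => ?_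
            rw [ENNReal.ofReal_mul (by positivity)]
            refine (mul_le_mul_left (rpow_norm_le_tsum hα p) _).trans (le_of_eq ?_)
            rw [← ENNReal.tsum_mul_right]
            refine tsum_congr fun ik => ?_
            rw [mul_assoc, ENNReal.ofReal_mul (p := _ ^ 2) (by positivity)]
        _ = ∑' ik : Fin d × ℕ, ENNReal.ofReal (2 ^ (α * (ik.2 + 1))) * ∑' p,
            ENNReal.ofReal (‖UnitAddTorus.mFourier p (dyadicShift ik.1 ik.2) - 1‖ ^ 2 *
              ‖fcoeff f p‖ ^ 2) := by
            rw [ENNReal.tsum_comm]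
            simp only [ENNReal.tsum_mul_left]
        _ ≤ _ := by
            refine ENNReal.tsum_le_tsum fun ik => ?_
            refine (mul_le_mul_right (tsum_shift_fcoeff_le hα.le hK f hf _
              (norm_dyadicShift_le ik.1 ik.2)) _).trans ?_
            rw [← ENNReal.ofReal_mul (by positivity)]
            refine ENNReal.ofReal_le_ofReal ?_
            have e : (((1 / 2 : ℝ) ^ (ik.2 + 2)) ^ α) = 2 ^ (-α * (ik.2 + 2)) := by
              rw [one_div, ← Real.rpow_natCast, Real.inv_rpow zero_le_two,
                ← Real.rpow_neg zero_le_two, ← Real.rpow_mul zero_le_two]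
              congr 1
              push_cast
              ring
            rw [e, mul_pow, mul_left_comm]
            gcongr
            rw [← Real.rpow_natCast (_ ^ (-α)), ← Real.rpow_mul zero_le_two,
              ← Real.rpow_natCast (_ ^ (-α * _)), ← Real.rpow_mul zero_le_two,
              ← Real.rpow_add two_pos]
            refine Real.rpow_le_rpow_of_exponent_le one_le_two ?_
            push_cast
            nlinarith
  refine (ENNReal.summable_toReal hfin).congr fun p => ?_
  rw [ENNReal.toReal_ofReal (by positivity)]

end Sobolev

/-! ### Exponential decay of correlations -/

section Decay

variable {d : ℕ}

lemma one_le_norm_of_ne_zero {p : Fin d → ℤ} (hp : p ≠ 0) : 1 ≤ ‖p‖ := by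
  obtain ⟨j, hj⟩ := Function.ne_iff.1 hp
  refine le_trans ?_ (norm_le_pi_norm p j)
  rw [Int.norm_eq_abs]
  exact_mod_cast Int.one_le_abs hj

/-- The action of `A ∈ SL(d, ℤ)` on frequencies, as a permutation. -/
def mulVecEquiv (A : SLZ d) : (Fin d → ℤ) ≃ (Fin d → ℤ) where
  toFun := (A : Matrix (Fin d) (Fin d) ℤ).mulVec
  invFun := ((A⁻¹ : SLZ d) : Matrix (Fin d) (Fin d) ℤ).mulVec
  left_inv p := by
    rw [Matrix.mulVec_mulVec, ← Matrix.SpecialLinearGroup.coe_mul, inv_mul_cancel,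
      Matrix.SpecialLinearGroup.coe_one, Matrix.one_mulVec]
  right_inv p := by
    rw [Matrix.mulVec_mulVec, ← Matrix.SpecialLinearGroup.coe_mul, mul_inv_cancel,
      Matrix.SpecialLinearGroup.coe_one, Matrix.one_mulVec]

/-- Correlation bound under the action of a single expanding matrix. -/
lemma abs_integral_mul_comp_tau_le {α C δ b L : ℝ} (hC : 0 < C) (hL : 0 < L)
    (hb : 0 < b) (hb1 : 2 * b ≤ α) (hb2 : 2 * b * δ ≤ α)
    (f : C(Torus d, ℝ)) (f' : C(Torus d, ℂ)) (hff' : ∀ t, f' t = (f t : ℂ))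
    (hf0 : ∫ t, f t = 0)
    (hsum : Summable fun p => ‖p‖ ^ α * ‖fcoeff f' p‖ ^ 2) (P : SLZ d)
    (hP : ∀ p : Fin d → ℤ, p ≠ 0 →
      C * ‖p‖ ^ (-δ) * L ≤ ‖(P : Matrix (Fin d) (Fin d) ℤ).mulVec p‖) :
    |∫ t, f t * f (tau P t)| ≤
      (∑' p, ‖p‖ ^ α * ‖fcoeff f' p‖ ^ 2) * C ^ (-b) * L ^ (-b) := by
  -- The zero mean removes the one frequency that is not expanded.
  have hc0 : fcoeff f' 0 = 0 := by
    simp only [fcoeff, neg_zero, UnitAddTorus.mFourier_zero, ContinuousMap.one_apply, one_mul, hff']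
    rw [integral_complex_ofReal, hf0, Complex.ofReal_zero]
  have hPar := hasSum_fcoeff f' (f'.comp ⟨tau P, continuous_tau P⟩)
  have hint : ∫ t, starRingEnd ℂ (f' t) * (f'.comp ⟨tau P, continuous_tau P⟩) t =
      ((∫ t, f t * f (tau P t) : ℝ) : ℂ) := by
    rw [← integral_complex_ofReal]
    simp [hff']
  -- Reindexing by p ↦ P p turns Parseval's sum into one of conj(c_{Pp}) c_p.
  rw [hint, ← (mulVecEquiv P).hasSum_iff] at hPar
  have hterm : ∀ p, ‖((fun p => starRingEnd ℂ (fcoeff f' p) *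
        fcoeff (f'.comp ⟨tau P, continuous_tau P⟩) p) ∘ mulVecEquiv P) p‖ ≤
      C ^ (-b) * L ^ (-b) * ((‖mulVecEquiv P p‖ ^ α * ‖fcoeff f' (mulVecEquiv P p)‖ ^ 2 +
        ‖p‖ ^ α * ‖fcoeff f' p‖ ^ 2) / 2) := by
    intro p
    have he : fcoeff (f'.comp ⟨tau P, continuous_tau P⟩) (mulVecEquiv P p) = fcoeff f' p :=
      fcoeff_comp_tau f'.continuous P p
    simp only [Function.comp_apply, he, norm_mul, RCLike.norm_conj]
    rcases eq_or_ne p 0 with rfl | hp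
    · rw [hc0, norm_zero, mul_zero]
      positivity
    have hPp : mulVecEquiv P p ≠ 0 := by
      intro h
      apply hp
      have h0 : mulVecEquiv P 0 = 0 :=
        Matrix.mulVec_zero (P : Matrix (Fin d) (Fin d) ℤ)
      exact (mulVecEquiv P).injective (h.trans h0.symm)
    have hn1 := one_le_norm_of_ne_zero hp
    have hn2 := one_le_norm_of_ne_zero hPp
    have hexp : C * ‖p‖ ^ (-δ) * L ≤ ‖mulVecEquiv P p‖ := hP p hp
    have hu := norm_nonneg (fcoeff f' (mulVecEquiv P p))
    have hv := norm_nonneg (fcoeff f' p)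
    generalize ‖mulVecEquiv P p‖ = y at *
    generalize ‖p‖ = x at *
    generalize ‖fcoeff f' (mulVecEquiv P p)‖ = u at *
    generalize ‖fcoeff f' p‖ = v at *
    have hx0 : 0 < x := by linarith
    have hy0 : 0 < y := by linarith
    have hCL : C * L ≤ y * x ^ δ := by
      rw [Real.rpow_neg hx0.le] at hexp
      have hxd : 0 < x ^ δ := by positivity
      calc C * L = C * (x ^ δ)⁻¹ * L * x ^ δ := by field_simp
        _ ≤ _ := by gcongr
    -- Expansion reads CL ≤ ‖Pp‖ ‖p‖^δ; its b-th power is shared between the two coefficients, and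
    -- AM–GM then bounds each term by half the sum of two Sobolev weights.
    have h1 : 1 ≤ C ^ (-b) * L ^ (-b) * (y ^ b * x ^ (δ * b)) := by
      rw [← Real.mul_rpow hC.le hL.le, Real.rpow_mul hx0.le, ← Real.mul_rpow hy0.le (by positivity),
        Real.rpow_neg (by positivity), inv_mul_eq_div, one_le_div (by positivity)]
      gcongr
    have h2 : (y ^ b * u) ^ 2 ≤ y ^ α * u ^ 2 := by
      rw [mul_pow, ← Real.rpow_natCast (y ^ b), ← Real.rpow_mul hy0.le]
      gcongr
      push_cast; linarith
    have h3 : (x ^ (δ * b) * v) ^ 2 ≤ x ^ α * v ^ 2 := by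
      rw [mul_pow, ← Real.rpow_natCast (x ^ (δ * b)), ← Real.rpow_mul hx0.le]
      gcongr
      push_cast; linarith
    have huv : u * v ≤ C ^ (-b) * L ^ (-b) * ((y ^ b * u) * (x ^ (δ * b) * v)) := by
      have huv0 : 0 ≤ u * v := mul_nonneg hu hv
      calc u * v = 1 * (u * v) := (one_mul _).symm
        _ ≤ C ^ (-b) * L ^ (-b) * (y ^ b * x ^ (δ * b)) * (u * v) := by gcongr
        _ = _ := by ring
    refine huv.trans ?_
    gcongr
    nlinarith [sq_nonneg (y ^ b * u - x ^ (δ * b) * v)]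
  have hs2 : Summable fun p => ‖mulVecEquiv P p‖ ^ α * ‖fcoeff f' (mulVecEquiv P p)‖ ^ 2 :=
    (mulVecEquiv P).summable_iff.2 hsum
  have hbound := hPar.norm_le_of_bounded
    (((hs2.hasSum.add hsum.hasSum).div_const 2).mul_left (C ^ (-b) * L ^ (-b))) hterm
  rw [Complex.norm_real, Real.norm_eq_abs] at hbound
  have htsum : ∑' p, ‖mulVecEquiv P p‖ ^ α * ‖fcoeff f' (mulVecEquiv P p)‖ ^ 2 =
      ∑' p, ‖p‖ ^ α * ‖fcoeff f' p‖ ^ 2 :=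
    (mulVecEquiv P).tsum_eq fun p => ‖p‖ ^ α * ‖fcoeff f' p‖ ^ 2
  rw [htsum] at hbound
  refine hbound.trans (le_of_eq ?_)
  ring

/-- Exponential decay of correlations, uniform over products of matrices in `𝒜`. -/
lemma exists_correlation_decay {𝒜 : Finset (SLZ d)} (hexp : UniformExpansion 𝒜) {α : ℝ≥0}
    (hα : 0 < α) {f : Torus d → ℝ} (hf : f ∈ holderCentered d α) :
    ∃ K ρ : ℝ, 0 ≤ K ∧ 0 ≤ ρ ∧ ρ < 1 ∧ ∀ r : ℕ, 1 ≤ r → ∀ B : Fin r → SLZ d, (∀ i, B i ∈ 𝒜) →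
      |∫ t, f t * f (tau (List.ofFn B).prod t)| ≤ K * ρ ^ r := by
  obtain ⟨⟨K, hK⟩, hf0⟩ := hf
  obtain ⟨C, δ, lam, hC, hδ, hlam, h⟩ := hexp
  have hfc : Continuous f := hK.continuous hα
  have hα' : (0 : ℝ) < α := by exact_mod_cast hα
  set f' : C(Torus d, ℂ) := ⟨fun t => (f t : ℂ), by fun_prop⟩ with hf'
  have hsum := summable_rpow_norm_mul_fcoeff_sq hα' K.2 f' (fun x y => by
    have := hK.dist_le x y
    rw [Real.dist_eq] at this
    simp only [hf', ContinuousMap.coe_mk]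
    rw [← Complex.ofReal_sub, Complex.norm_real]
    exact this)
  -- The largest b for which both powers, ‖Pp‖^(2b) and ‖p‖^(2bδ), are absorbed by the weight of
  -- exponent α.
  set b : ℝ := min (α : ℝ) (α / δ) / 2 with hb
  have hb0 : 0 < b := by positivity
  have hb1 : 2 * b ≤ α := by rw [hb, mul_div_cancel₀ _ two_ne_zero]; exact min_le_left _ _
  have hb2 : 2 * b * δ ≤ α := by
    rw [hb, mul_div_cancel₀ _ two_ne_zero, ← le_div_iff₀ hδ]; exact min_le_right _ _
  refine ⟨(∑' p, ‖p‖ ^ (α : ℝ) * ‖fcoeff f' p‖ ^ 2) * C ^ (-b), lam ^ (-b), ?_, ?_, ?_, ?_⟩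
  · exact mul_nonneg (tsum_nonneg fun p => by positivity) (by positivity)
  · positivity
  · exact Real.rpow_lt_one_of_one_lt_of_neg hlam (by linarith)
  · intro r hr B hB
    have := abs_integral_mul_comp_tau_le (L := lam ^ r) hC (by positivity) hb0 hb1 hb2 ⟨f, hfc⟩ f'
      (fun t => rfl) hf0 hsum (List.ofFn B).prod (h r hr B hB)
    refine this.trans (le_of_eq ?_)
    rw [← Real.rpow_natCast lam, ← Real.rpow_natCast (lam ^ (-b)), ← Real.rpow_mul (by positivity),
      ← Real.rpow_mul (by positivity), mul_comm (r : ℝ)]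

end Decay

/-! ### Variance of the sums along the cocycle -/

section Cocycle

variable {Ω : Type*} {d : ℕ} {θ : Ω → Ω} {A : Ω → SLZ d} {f : Torus d → ℝ}

lemma tauProd_eq_tau (k : ℕ) (ω : Ω) (t : Torus d) :
    tauProd θ A k ω t = tau (List.ofFn fun i : Fin k => A (θ^[i] ω)).prod t := by
  induction k with
  | zero => simp [tauProd, tau_one]
  | succ k ih =>
    rw [List.ofFn_succ', List.prod_concat, tau_mul]
    simp only [Fin.val_castSucc, Fin.val_last, tauProd, ih]

lemma tauProd_succ_left (k : ℕ) (ω : Ω) (t : Torus d) :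
    tauProd θ A (k + 1) ω t = tauProd θ A k (θ ω) (tau (A ω) t) := by
  induction k with
  | zero => rfl
  | succ k ih => rw [tauProd, ih, tauProd, Function.iterate_succ_apply]

lemma iterate_skewProduct_snd (k : ℕ) (z : Ω × Torus d) :
    ((skewProduct θ A)^[k] z).2 = tauProd θ A k z.1 z.2 := by
  induction k generalizing z with
  | zero => rfl
  | succ k ih => rw [Function.iterate_succ_apply, ih, tauProd_succ_left]; rfl

lemma birkhoffS_eq_sum_range (n : ℕ) (ω : Ω) (t : Torus d) :
    birkhoffS θ A n ω f t = ∑ k ∈ Finset.range n, f (tauProd θ A (k + 1) ω t) := by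
  rw [birkhoffS, Finset.range_eq_Ico, Finset.sum_Ico_add' (fun k => f (tauProd θ A k ω t)) 0 n 1,
    zero_add]
  rfl

lemma birkhoffS_succ_left (n : ℕ) (ω : Ω) (t : Torus d) :
    birkhoffS θ A (n + 1) ω f t =
      f (tau (A ω) t) + birkhoffS θ A n (θ ω) f (tau (A ω) t) := by
  rw [birkhoffS_eq_sum_range, birkhoffS_eq_sum_range, Finset.sum_range_succ', add_comm]
  simp only [tauProd_succ_left _ ω]
  rfl

lemma continuous_tauProd (k : ℕ) (ω : Ω) : Continuous (tauProd θ A k ω) := by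
  rw [funext (tauProd_eq_tau k ω)]
  exact continuous_tau _

lemma continuous_birkhoffS (hf : Continuous f) (n : ℕ) (ω : Ω) :
    Continuous (birkhoffS θ A n ω f) := by
  unfold birkhoffS
  exact continuous_finsetSum _ fun k _ => hf.comp (continuous_tauProd k ω)

/-- The correlation `∫ f(t) f(τ(r, ω) t) dt`. -/
def corr (θ : Ω → Ω) (A : Ω → SLZ d) (f : Torus d → ℝ) (r : ℕ) (ω : Ω) : ℝ :=
  ∫ t, f t * f (tauProd θ A r ω t)

/-- The squared norm `∫ S_n(ω, f)² dt`. -/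
def sqS (θ : Ω → Ω) (A : Ω → SLZ d) (f : Torus d → ℝ) (n : ℕ) (ω : Ω) : ℝ :=
  ∫ t, birkhoffS θ A n ω f t ^ 2

/-- The variance density `∫ f² + 2 ∑_{r ≥ 1} ∫ f(t) f(τ(r, ω) t) dt`. -/
def varDensity (θ : Ω → Ω) (A : Ω → SLZ d) (f : Torus d → ℝ) (ω : Ω) : ℝ :=
  (∫ t, f t ^ 2) + 2 * ∑' r, corr θ A f (r + 1) ω

/-- S_{n+1}(ω) is f + S_n(θω) composed with the measure-preserving τ(ω); the cross terms of the
square are correlations based at θω. -/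
lemma sqS_succ (hf : Continuous f) (n : ℕ) (ω : Ω) :
    sqS θ A f (n + 1) ω = (∫ t, f t ^ 2) + 2 * ∑ r ∈ Finset.range n, corr θ A f (r + 1) (θ ω) +
      sqS θ A f n (θ ω) := by
  have hS : Continuous (birkhoffS θ A n (θ ω) f) := continuous_birkhoffS hf n (θ ω)
  have hT : ∀ r, Continuous (tauProd θ A r (θ ω)) := fun r => continuous_tauProd r (θ ω)
  have hcont : Continuous fun t => (f t + birkhoffS θ A n (θ ω) f t) ^ 2 := by fun_prop
  have h1 : sqS θ A f (n + 1) ω = ∫ t, (f t + birkhoffS θ A n (θ ω) f t) ^ 2 := by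
    simp only [sqS, birkhoffS_succ_left]
    conv_rhs => rw [← (measurePreserving_tau (A ω)).map_eq]
    exact (integral_map (measurePreserving_tau (A ω)).measurable.aemeasurable
      hcont.aestronglyMeasurable).symm
  have h2 : ∀ t, (f t + birkhoffS θ A n (θ ω) f t) ^ 2 = f t ^ 2 +
      2 * ∑ r ∈ Finset.range n, f t * f (tauProd θ A (r + 1) (θ ω) t) +
        birkhoffS θ A n (θ ω) f t ^ 2 := by
    intro t
    rw [← Finset.mul_sum, ← birkhoffS_eq_sum_range]
    ring
  rw [h1]
  simp only [h2, corr, sqS]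
  rw [integral_add (integrable_torus (by fun_prop)) (integrable_torus (by fun_prop)),
    integral_add (integrable_torus (by fun_prop)) (integrable_torus (by fun_prop)),
    integral_const_mul, integral_finsetSum _ fun r _ => integrable_torus (by fun_prop)]

lemma toReal_eLpNorm_two_sq {X : Type*} [MeasurableSpace X] {m : Measure X} {g : X → ℝ}
    (hg : MemLp g 2 m) : (eLpNorm g 2 m).toReal ^ 2 = ∫ x, g x ^ 2 ∂m := by
  have h0 : 0 ≤ ∫ x, g x ^ 2 ∂m := integral_nonneg fun x => sq_nonneg _
  rw [hg.eLpNorm_eq_integral_rpow_norm two_ne_zero ENNReal.ofNat_ne_top]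
  simp only [ENNReal.toReal_ofNat, Real.rpow_two, Real.norm_eq_abs, sq_abs]
  rw [ENNReal.toReal_ofReal (by positivity), ← Real.rpow_natCast, ← Real.rpow_mul h0]
  norm_num

lemma memLp_torus (hf : Continuous f) : MemLp f 2 volume :=
  hf.memLp_of_hasCompactSupport (HasCompactSupport.of_compactSpace f)

lemma normS_eq_sqrt (hf : Continuous f) (n : ℕ) (ω : Ω) :
    normS θ A n ω f = √(sqS θ A f n ω) := by
  rw [sqS, ← toReal_eLpNorm_two_sq (memLp_torus (continuous_birkhoffS hf n ω)),
    Real.sqrt_sq ENNReal.toReal_nonneg, normS]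

section Variance

variable {K ρ : ℝ}

lemma abs_sum_corr_sub_tsum_le (hρ : 0 ≤ ρ) (hρ1 : ρ < 1)
    (h : ∀ r ω, |corr θ A f (r + 1) ω| ≤ K * ρ ^ r) (n : ℕ) (ω : Ω) :
    |∑ r ∈ Finset.range n, corr θ A f (r + 1) ω - ∑' r, corr θ A f (r + 1) ω| ≤
      K * ρ ^ n / (1 - ρ) := by
  have hs : Summable fun r => corr θ A f (r + 1) ω :=
    Summable.of_norm_bounded ((summable_geometric_of_lt_one hρ hρ1).mul_left K) fun r => h r ω
  rw [← Real.dist_eq]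
  refine dist_le_of_le_geometric_of_tendsto
    (f := fun n => ∑ r ∈ Finset.range n, corr θ A f (r + 1) ω)
    ρ K hρ1 (fun m => ?_) hs.hasSum.tendsto_sum_nat n
  rw [dist_comm, Real.dist_eq, Finset.sum_range_succ, add_sub_cancel_left]
  exact h m ω

/-- By `sqS_succ`, step n replaces a correlation sum of length n by the full series, an error of
2Kρ^n/(1-ρ), summable in n. The base point is θω because S_n starts at k = 1. -/
lemma abs_sqS_sub_birkhoffSum_le (hf : Continuous f) (hK : 0 ≤ K) (hρ : 0 ≤ ρ) (hρ1 : ρ < 1)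
    (h : ∀ r ω, |corr θ A f (r + 1) ω| ≤ K * ρ ^ r) (n : ℕ) (ω : Ω) :
    |sqS θ A f n ω - birkhoffSum θ (varDensity θ A f) n (θ ω)| ≤
      2 * K / (1 - ρ) * (1 - ρ)⁻¹ := by
  have h1ρ : 0 < 1 - ρ := by linarith
  have key : |sqS θ A f n ω - birkhoffSum θ (varDensity θ A f) n (θ ω)| ≤
      2 * K / (1 - ρ) * ∑ m ∈ Finset.range n, ρ ^ m := by
    induction n generalizing ω with
    | zero => simp [sqS, birkhoffS]
    | succ n ih =>
      have h1 := abs_sum_corr_sub_tsum_le hρ hρ1 h n (θ ω)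
      have h2 := ih (θ ω)
      rw [sqS_succ hf, birkhoffSum_succ', Finset.sum_range_succ, mul_add, varDensity]
      have h3 : 2 * K / (1 - ρ) * ρ ^ n = 2 * (K * ρ ^ n / (1 - ρ)) := by ring
      rw [h3]
      rw [abs_le] at h1 h2 ⊢
      constructor <;> linarith [h1.1, h1.2, h2.1, h2.2]
  refine key.trans ?_
  have : 0 ≤ 2 * K / (1 - ρ) := by positivity
  gcongr
  rw [← tsum_geometric_of_lt_one hρ hρ1]
  exact (summable_geometric_of_lt_one hρ hρ1).sum_le_tsum _ fun m _ => by positivity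

lemma abs_varDensity_le (hρ : 0 ≤ ρ) (hρ1 : ρ < 1)
    (h : ∀ r ω, |corr θ A f (r + 1) ω| ≤ K * ρ ^ r) (ω : Ω) :
    |varDensity θ A f ω| ≤ (∫ t, f t ^ 2) + 2 * (K / (1 - ρ)) := by
  have h1 := abs_sum_corr_sub_tsum_le hρ hρ1 h 0 ω
  have h0 : 0 ≤ ∫ t, f t ^ 2 := integral_nonneg fun x => sq_nonneg _
  rw [Finset.sum_range_zero, zero_sub, abs_neg, pow_zero, mul_one, abs_le] at h1
  rw [varDensity, abs_le]
  constructor <;> linarith [h1.1, h1.2]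

end Variance

end Cocycle

/-! ### The skew product and its Koopman operator -/

section Measurability

variable {Ω : Type*} [MeasurableSpace Ω] {μ : Measure Ω} {d : ℕ} {θ : Ω → Ω} {A : Ω → SLZ d}
  {f : Torus d → ℝ}

/-- SL(d, ℤ) is countable, so with the discrete σ-algebra joint measurability is checked one matrix
at a time. -/
lemma measurable_tau_uncurry (hA : ∀ B, MeasurableSet (A ⁻¹' {B})) :
    Measurable (Function.uncurry fun ω t => tau (A ω) t) := by
  let : MeasurableSpace (SLZ d) := ⊤
  have : Countable (Matrix (Fin d) (Fin d) ℤ) := inferInstanceAs (Countable (Fin d → Fin d → ℤ))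
  have : Countable (SLZ d) := Subtype.countable
  have hAm : Measurable A := measurable_to_countable' hA
  have h2 : Measurable fun z : SLZ d × Torus d => tau z.1 z.2 :=
    measurable_from_prod_countable_right fun B => (continuous_tau B).measurable
  exact h2.comp (hAm.prodMap measurable_id)

lemma measurePreserving_skewProduct [IsProbabilityMeasure μ] (hθ : MeasurePreserving θ μ μ)
    (hA : ∀ B, MeasurableSet (A ⁻¹' {B})) :
    MeasurePreserving (skewProduct θ A) (μ.prod volume) (μ.prod volume) :=
  hθ.skew_product (measurable_tau_uncurry hA)
    (Eventually.of_forall fun ω => (measurePreserving_tau (A ω)).map_eq)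

lemma measurable_corr (hθ : Measurable θ) (hA : ∀ B, MeasurableSet (A ⁻¹' {B}))
    (hf : Continuous f) (r : ℕ) : Measurable (corr θ A f r) := by
  have hsk : Measurable (skewProduct θ A) :=
    (hθ.comp measurable_fst).prodMk (measurable_tau_uncurry hA)
  have hm : Measurable fun z : Ω × Torus d => f z.2 * f (tauProd θ A r z.1 z.2) := by
    simp only [← iterate_skewProduct_snd]
    exact (hf.measurable.comp measurable_snd).mul
      (hf.measurable.comp (measurable_snd.comp (hsk.iterate r)))
  exact hm.stronglyMeasurable.integral_prod_right'.measurable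

lemma measurable_varDensity (hθ : Measurable θ) (hA : ∀ B, MeasurableSet (A ⁻¹' {B}))
    (hf : Continuous f) : Measurable (varDensity θ A f) :=
  ((Measurable.tsum (L := .unconditional ℕ) fun r =>
    measurable_corr hθ hA hf (r + 1)).const_mul 2).const_add _

lemma integral_birkhoffSum_comp (hθ : MeasurePreserving θ μ μ) {g : Ω → ℝ} (hg : Integrable g μ)
    (n : ℕ) : Integrable (fun ω => birkhoffSum θ g n (θ ω)) μ ∧
      ∫ ω, birkhoffSum θ g n (θ ω) ∂μ = n * ∫ ω, g ω ∂μ := by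
  have hk : ∀ k, Integrable (fun ω => g (θ^[k] (θ ω))) μ := fun k =>
    (hθ.iterate (k + 1)).integrable_comp_of_integrable hg
  refine ⟨integrable_finsetSum _ fun k _ => hk k, ?_⟩
  simp only [birkhoffSum]
  rw [integral_finsetSum _ fun k _ => hk k]
  have : ∀ k, ∫ ω, g (θ^[k] (θ ω)) ∂μ = ∫ ω, g ω ∂μ := fun k => by
    have hmp := hθ.iterate (k + 1)
    conv_rhs => rw [← hmp.map_eq]
    exact (integral_map hmp.measurable.aemeasurable
      (by rw [hmp.map_eq]; exact hg.aestronglyMeasurable)).symm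
  simp [this]

lemma memLp_comp_snd [IsProbabilityMeasure μ] (hf : Continuous f) :
    MemLp (fun z : Ω × Torus d => f z.2) 2 (μ.prod volume) :=
  (memLp_torus hf).comp_measurePreserving measurePreserving_snd

/-- The Koopman operator of the skew product on `L²`. -/
def koopman [IsProbabilityMeasure μ] (hθ : MeasurePreserving θ μ μ)
    (hA : ∀ B, MeasurableSet (A ⁻¹' {B})) :
    Lp ℝ 2 (μ.prod (volume : Measure (Torus d))) →ₗᵢ[ℝ]
      Lp ℝ 2 (μ.prod (volume : Measure (Torus d))) :=
  Lp.compMeasurePreservingₗᵢ ℝ _ (measurePreserving_skewProduct (d := d) hθ hA)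

lemma koopman_toLp [IsProbabilityMeasure μ] (hθ : MeasurePreserving θ μ μ)
    (hA : ∀ B, MeasurableSet (A ⁻¹' {B})) {g : Ω × Torus d → ℝ} (hg : MemLp g 2 (μ.prod volume)) :
    koopman hθ hA hg.toLp =
      (hg.comp_measurePreserving (measurePreserving_skewProduct hθ hA)).toLp :=
  Lp.toLp_compMeasurePreserving hg _

/-- The outer Koopman operator accounts for the sum starting at k = 1; being an isometry, it does
not affect norms. -/
lemma exists_toLp_birkhoffS [IsProbabilityMeasure μ] (hθ : MeasurePreserving θ μ μ)
    (hA : ∀ B, MeasurableSet (A ⁻¹' {B})) (hf : Continuous f) (n : ℕ) :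
    ∃ h : MemLp (fun z : Ω × Torus d => birkhoffS θ A n z.1 f z.2) 2 (μ.prod volume),
      h.toLp = koopman hθ hA (birkhoffSum (koopman hθ hA) id n (memLp_comp_snd hf).toLp) := by
  induction n with
  | zero =>
    have heq : (fun z : Ω × Torus d => birkhoffS θ A 0 z.1 f z.2) = 0 := by
      funext z
      simp [birkhoffS]
    have hmem : MemLp (fun z : Ω × Torus d => birkhoffS θ A 0 z.1 f z.2) 2 (μ.prod volume) := by
      rw [heq]
      exact MemLp.zero
    refine ⟨hmem, ?_⟩
    rw [birkhoffSum_zero, map_zero]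
    exact (MemLp.toLp_eq_toLp_iff hmem MemLp.zero).2 (Eventually.of_forall fun z => congrFun heq z)
  | succ n ih =>
    obtain ⟨h, hh⟩ := ih
    have hsum := (memLp_comp_snd (μ := μ) hf).add h
    have heq : (fun z : Ω × Torus d => birkhoffS θ A (n + 1) z.1 f z.2) =
        ((fun z : Ω × Torus d => f z.2) + fun z => birkhoffS θ A n z.1 f z.2) ∘
          skewProduct θ A := by
      funext z
      exact birkhoffS_succ_left n z.1 z.2
    have hmem := hsum.comp_measurePreserving (measurePreserving_skewProduct hθ hA)
    have hmem' : MemLp (fun z : Ω × Torus d => birkhoffS θ A (n + 1) z.1 f z.2) 2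
        (μ.prod volume) := by
      rw [heq]
      exact hmem
    refine ⟨hmem', ?_⟩
    have h1 : hmem'.toLp = hmem.toLp :=
      MemLp.toLp_congr _ _ (Eventually.of_forall fun z => congrFun heq z)
    have h2 : birkhoffSum (koopman hθ hA) id (n + 1) (memLp_comp_snd (μ := μ) hf).toLp =
        hsum.toLp := by
      rw [MemLp.toLp_add (memLp_comp_snd hf) h, hh, map_birkhoffSum_id, add_sub_cancel]
    rw [h1, h2, koopman_toLp]

/-- The squared norm of the Birkhoff sums of `f` in `L²(μ ⊗ dt)`. -/
lemma norm_birkhoffSum_koopman_sq [IsProbabilityMeasure μ] (hθ : MeasurePreserving θ μ μ)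
    (hA : ∀ B, MeasurableSet (A ⁻¹' {B})) (hf : Continuous f) (n : ℕ) :
    Integrable (sqS θ A f n) μ ∧
    ‖birkhoffSum (koopman hθ hA) id n (memLp_comp_snd (μ := μ) hf).toLp‖ ^ 2 =
      ∫ ω, sqS θ A f n ω ∂μ := by
  obtain ⟨h, hh⟩ := exists_toLp_birkhoffS hθ hA hf n
  refine ⟨h.integrable_sq.integral_prod_left, ?_⟩
  rw [← (koopman hθ hA).norm_map, ← hh, Lp.norm_toLp, toReal_eLpNorm_two_sq h,
    integral_prod _ h.integrable_sq]
  rfl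

lemma isL2Coboundary_iff [IsProbabilityMeasure μ] (hθ : MeasurePreserving θ μ μ)
    (hA : ∀ B, MeasurableSet (A ⁻¹' {B})) (hf : Continuous f) :
    IsL2Coboundary μ θ A f ↔
      ∃ h, koopman hθ hA h - h = (memLp_comp_snd (μ := μ) hf).toLp := by
  constructor
  · rintro ⟨h, hmem, hh⟩
    refine ⟨hmem.toLp, ?_⟩
    rw [koopman_toLp, ← MemLp.toLp_sub]
    refine MemLp.toLp_congr _ _ ?_
    filter_upwards [hh] with z hz
    exact hz.symm
  · rintro ⟨h, hh⟩
    refine ⟨h, Lp.memLp h, ?_⟩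
    have h1 := Lp.coeFn_compMeasurePreserving h (measurePreserving_skewProduct hθ hA)
    have h2 := Lp.coeFn_sub (koopman hθ hA h) h
    rw [hh] at h2
    filter_upwards [h1, h2, (memLp_comp_snd (μ := μ) hf).coeFn_toLp] with z hz1 hz2 hz3
    rw [← hz3, hz2, Pi.sub_apply]
    exact congrArg (· - h z) hz1

end Measurability

/-- Existence of the asymptotic variance, and its vanishing exactly for `L²` coboundaries. -/
theorem exists_limit_variance {d : ℕ}
    {Ω : Type*} [MeasurableSpace Ω] (μ : Measure Ω) [IsProbabilityMeasure μ]
    (θ : Ω → Ω) (hθ : Ergodic θ μ)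
    (𝒜 : Finset (SLZ d)) (hexp : UniformExpansion 𝒜)
    (A : Ω → SLZ d) (hA : ∀ ω, A ω ∈ 𝒜)
    (hAmeas : ∀ B, MeasurableSet (A ⁻¹' {B}))
    (α : ℝ≥0) (hα : 0 < α)
    (f : Torus d → ℝ) (hf : f ∈ holderCentered d α) :
    ∃ σ : ℝ,
      (∀ᵐ ω ∂μ, Tendsto
        (fun n : ℕ => (n : ℝ) ^ (-(1 / 2) : ℝ) * normS θ A n ω f) atTop (𝓝 σ)) ∧
      (σ = 0 ↔ IsL2Coboundary μ θ A f) := by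
  have hfc : Continuous f := by
    obtain ⟨⟨K, hK⟩, -⟩ := hf
    exact hK.continuous hα
  have hmp := hθ.toMeasurePreserving
  obtain ⟨K, ρ, hK, hρ, hρ1, hdecay⟩ := exists_correlation_decay hexp hα hf
  have hcorr : ∀ r ω, |corr θ A f (r + 1) ω| ≤ K * ρ ^ r := by
    intro r ω
    simp only [corr, tauProd_eq_tau]
    refine (hdecay (r + 1) (Nat.le_add_left 1 r) _ fun i => hA _).trans ?_
    have := pow_le_pow_of_le_one hρ hρ1.le (Nat.le_succ r)
    gcongr
  set ψ := varDensity θ A f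
  have hψm : Measurable ψ := measurable_varDensity hmp.measurable hAmeas hfc
  have hψi : Integrable ψ μ := Integrable.of_bound hψm.aestronglyMeasurable _
    (Eventually.of_forall (abs_varDensity_le hρ hρ1 hcorr))
  set D := 2 * K / (1 - ρ) * (1 - ρ)⁻¹
  have hbound : ∀ n ω, |sqS θ A f n ω - birkhoffSum θ ψ n (θ ω)| ≤ D :=
    abs_sqS_sub_birkhoffSum_le hfc hK hρ hρ1 hcorr
  set v := ∫ ω, ψ ω ∂μ
  have hlim : ∀ᵐ ω ∂μ, Tendsto (fun n : ℕ => sqS θ A f n ω / n) atTop (𝓝 v) := by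
    -- The Birkhoff sums are based at θω, so the full-measure set is pulled back by θ.
    filter_upwards [hmp.quasiMeasurePreserving.ae (ae_tendsto_birkhoffSum_div hθ hψm hψi)]
      with ω hω
    have h0 : Tendsto (fun n : ℕ => (sqS θ A f n ω - birkhoffSum θ ψ n (θ ω)) / n) atTop (𝓝 0) := by
      refine squeeze_zero_norm (a := fun n : ℕ => D / n) (fun n => ?_)
        (tendsto_const_div_atTop_nhds_zero_nat D)
      rw [norm_div, Real.norm_natCast]
      gcongr
      exact hbound n ω
    have h1 := h0.add hω
    rw [zero_add] at h1
    refine h1.congr fun n => ?_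
    rw [← add_div, sub_add_cancel]
  have hv0 : 0 ≤ v := by
    obtain ⟨ω, hω⟩ := hlim.exists
    exact ge_of_tendsto' hω fun n =>
      div_nonneg (integral_nonneg fun t => sq_nonneg _) n.cast_nonneg
  refine ⟨√v, ?_, ?_⟩
  · filter_upwards [hlim] with ω hω
    refine ((Real.continuous_sqrt.tendsto v).comp hω).congr fun n => ?_
    rw [Function.comp_apply, normS_eq_sqrt hfc, Real.sqrt_div' _ n.cast_nonneg,
      Real.rpow_neg n.cast_nonneg, ← Real.sqrt_eq_rpow, div_eq_inv_mul]
  · rw [Real.sqrt_eq_zero hv0, isL2Coboundary_iff hmp hAmeas hfc, ← bounded_ergodic_sums_iff]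
    -- Integrating the pointwise bound over Ω: the squared norm is nv + O(1), hence bounded in n
    -- only if v = 0.
    have hI : ∀ n : ℕ, |‖birkhoffSum (koopman hmp hAmeas) id n
        (memLp_comp_snd (μ := μ) hfc).toLp‖ ^ 2 - n * v| ≤ D := by
      intro n
      obtain ⟨hi, he⟩ := norm_birkhoffSum_koopman_sq hmp hAmeas hfc n
      obtain ⟨hi2, he2⟩ := integral_birkhoffSum_comp hmp hψi n
      rw [he, ← he2, ← integral_sub hi hi2, ← Real.norm_eq_abs]
      refine (norm_integral_le_of_norm_le_const (Eventually.of_forall (hbound n))).trans ?_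
      simp
    constructor
    · intro h0
      refine ⟨√D, fun n => ?_⟩
      have h1 := hI n
      rw [h0, mul_zero, sub_zero, abs_of_nonneg (by positivity)] at h1
      exact Real.le_sqrt_of_sq_le h1
    · rintro ⟨M, hM⟩
      by_contra hne
      have hvpos : 0 < v := lt_of_le_of_ne hv0 (Ne.symm hne)
      obtain ⟨n, hn⟩ := exists_nat_gt ((D + M ^ 2) / v)
      rw [div_lt_iff₀ hvpos] at hn
      have h1 := (abs_le.1 (hI n)).1
      have h2 := pow_le_pow_left₀ (norm_nonneg _) (hM n) 2
      linarith

end ToralProducts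

end

theorem mainTheorem6 {d : ℕ} (hd : 2 ≤ d)
    {Ω : Type*} [MeasurableSpace Ω] (μ : Measure Ω) [IsProbabilityMeasure μ]
    (θ : Ω ≃ᵐ Ω) (hθ : Ergodic θ μ)
    (𝒜 : Finset (ToralProducts.SLZ d)) (hexp : ToralProducts.UniformExpansion 𝒜)
    (A : Ω → ToralProducts.SLZ d) (hA : ∀ ω, A ω ∈ 𝒜)
    (hAmeas : ∀ B, MeasurableSet (A ⁻¹' {B}))
    (α : ℝ≥0) (hα : 0 < α)
    (f : ToralProducts.Torus d → ℝ) (hf : f ∈ ToralProducts.holderCentered d α) :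
    ∃ σ : ℝ,
      (∀ᵐ ω ∂μ, Tendsto
        (fun n : ℕ => (n : ℝ) ^ (-(1 / 2) : ℝ) * ToralProducts.normS θ A n ω f) atTop (𝓝 σ)) ∧
      (σ = 0 ↔ ToralProducts.IsL2Coboundary μ θ A f) := by
  exact ToralProducts.exists_limit_variance μ θ hθ 𝒜 hexp A hA hAmeas α hα f hf
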